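/- All topological spaces are Hausdorff. A paratopological group is a group $G$ with a topology for which the multiplication $G\times G\to G$ is continuous. For such $G$, let $G^\flat$ (the group reflexion) denote the group $G$ with the strongest group topology (not required to be Hausdorff) that is weaker than the topology of $G$; sets closed in $G^\flat$ are called $\flat$-closed. $G$ is called: saturated if $U^{-1}$ has non-empty interior for every non-empty open $U\subset G$; $\flat$-regular if each neighborhood of the unit contains a $\flat$-closed neighborhood of the unit; SIN if each neighborhood $U$ of the unit contains a neighborhood $W$ of the unit with $gWg^{-1}\subset U$ for all $g\in G$; Sorgenfrey if $G$ is non-discrete, saturated and has a neighborhood $U$ of the unit such that for every neighborhood $V$ of the unit there is a neighborhood $W$ of the unit such that $x,y\in V$ for all $x,y\in U$ with $xy\in W$. A continuous map $h:X\to Y$ is regular if for every $x\in X$ and every neighborhood $U$ of $x$ there is a closed $F\subset Y$ such that $h^{-1}(F)$ is a closed neighborhood of $x$ contained in $U$. The character $\chi(X)$ is the smallest infinite cardinal $\kappa$ such that each point of $X$ has a neighborhood base of size $\le\kappa$. A class $\mathcal G$ of topological groups is closed-hereditary if every closed subgroup of a group in $\mathcal G$ is in $\mathcal G$, and $K$-stable,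 for a topological group $K$, if $X\times K\in\mathcal G$ for every $X\in\mathcal G$. A paratopological group $H$ is $\mathcal G$-regular if there is a regular continuous bijective homomorphism from $H$ onto a group in $\mathcal G$. Theorem. Let $T$ be a first-countable, saturated, regular, Sorgenfrey paratopological SIN-group and let $\mathcal G$ be a closed-hereditary, $T^\flat$-stable class of first-countable topological SIN-groups. Then a paratopological group $H$ is $\mathcal G$-regular if and only if $H$ is (topologically isomorphic to) a $\flat$-closed subgroup of a saturated $\flat$-regular paratopological group $G$ such that $G^\flat\in\mathcal G$, $\chi(G)=\chi(H)$ and $|G/H|=|T|$. -/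

import Mathlib

universe u

namespace Paratop

open Topology Pointwise Cardinal

/-! A paratopological group is a group with a topology making the multiplication (jointly)
continuous, i.e. `[Group G] [TopologicalSpace G] [ContinuousMul G]`. -/

/-- Saturated: the inverse of every nonempty open set has nonempty interior. -/
def IsSaturated (G : Type u) [Group G] [TopologicalSpace G] : Prop :=
  ∀ U : Set G, IsOpen U → U.Nonempty → (interior U⁻¹).Nonempty

/-- SIN: every neighborhood `U` of the unit contains a neighborhood `W` of the unit with
`g W g⁻¹ ⊆ U` for all `g`. -/
def IsSIN (G : Type u) [Group G] [TopologicalSpace G] : Prop :=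
  ∀ U ∈ 𝓝 (1 : G), ∃ W ∈ 𝓝 (1 : G), W ⊆ U ∧ ∀ g : G, ∀ w ∈ W, g * w * g⁻¹ ∈ U

/-- Sorgenfrey: non-discrete, saturated, and there is a neighborhood `U` of the unit such that
for every neighborhood `V` of the unit there is a neighborhood `W` of the unit such that
`x, y ∈ V` for all `x, y ∈ U` with `x * y ∈ W`. -/
def IsSorgenfrey (G : Type u) [Group G] [TopologicalSpace G] : Prop :=
  ¬ DiscreteTopology G ∧ IsSaturated G ∧
    ∃ U ∈ 𝓝 (1 : G), ∀ V ∈ 𝓝 (1 : G), ∃ W ∈ 𝓝 (1 : G),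
      ∀ x ∈ U, ∀ y ∈ U, x * y ∈ W → x ∈ V ∧ y ∈ V

/-- The strongest group topology weaker than the given topology of `G`.
(In Mathlib's order on topologies `τ ≤ t` says that `t` is weaker than `τ`.) -/
@[reducible] def reflexionTopology (G : Type u) [Group G] [τ : TopologicalSpace G] : TopologicalSpace G :=
  sInf {t | τ ≤ t ∧ @IsTopologicalGroup G t _}

/-- `reflexionTopology G` is indeed the strongest group topology weaker than the topology
of `G`. -/
theorem reflexionTopology_isLeast (G : Type u) [Group G] [τ : TopologicalSpace G] :
    IsLeast {t : TopologicalSpace G | τ ≤ t ∧ @IsTopologicalGroup G t _}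
      (reflexionTopology G) :=
  ⟨⟨le_sInf fun _ ht => ht.1, topologicalGroup_sInf fun _ ht => ht.2⟩, fun _ ht => sInf_le ht⟩

/-- The group reflexion `G^♭`: the group `G` with the topology `reflexionTopology G`. -/
def Reflexion (G : Type u) : Type u := G

instance (G : Type u) [Group G] : Group (Reflexion G) := inferInstanceAs (Group G)

instance (G : Type u) [Group G] [TopologicalSpace G] : TopologicalSpace (Reflexion G) :=
  reflexionTopology G

/-- `♭`-closed: closed in the topology of the group reflexion. -/
def IsFlatClosed {G : Type u} [Group G] [TopologicalSpace G] (A : Set G) : Prop :=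
  IsClosed[reflexionTopology G] A

/-- `♭`-regular: each neighborhood of the unit contains a `♭`-closed neighborhood of the unit. -/
def IsFlatRegular (G : Type u) [Group G] [TopologicalSpace G] : Prop :=
  ∀ U ∈ 𝓝 (1 : G), ∃ F ∈ 𝓝 (1 : G), F ⊆ U ∧ IsFlatClosed F

/-- Regular map: for each point `x` and each neighborhood `U` of `x` there is a closed subset `F`
of the codomain whose preimage is a closed neighborhood of `x` contained in `U`. -/
def IsRegularMap {X Y : Type u} [TopologicalSpace X] [TopologicalSpace Y] (h : X → Y) : Prop :=
  ∀ x : X, ∀ U ∈ 𝓝 x, ∃ F : Set Y,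
    IsClosed F ∧ IsClosed (h ⁻¹' F) ∧ h ⁻¹' F ∈ 𝓝 x ∧ h ⁻¹' F ⊆ U

/-- The character: the smallest infinite cardinal `κ` such that each point has a neighborhood
base of size at most `κ`. -/
noncomputable def character (X : Type u) [TopologicalSpace X] : Cardinal.{u} :=
  sInf {κ | ℵ₀ ≤ κ ∧ ∀ x : X, ∃ B : Set (Set X), #B ≤ κ ∧ (𝓝 x).HasBasis (· ∈ B) id}

/-- Each member of the class `𝒢` is a Hausdorff first-countable topological SIN-group. -/
def IsClassOfFirstCountableSINGroups
    (𝒢 : ∀ (X : Type u) [Group X] [TopologicalSpace X], Prop) : Prop :=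
  ∀ (X : Type u) [Group X] [TopologicalSpace X], 𝒢 X →
    IsTopologicalGroup X ∧ T2Space X ∧ FirstCountableTopology X ∧ IsSIN X

/-- Closed-hereditary: each closed subgroup of a member of `𝒢` belongs to `𝒢`. -/
def IsClosedHereditary (𝒢 : ∀ (X : Type u) [Group X] [TopologicalSpace X], Prop) : Prop :=
  ∀ (X : Type u) [Group X] [TopologicalSpace X], 𝒢 X →
    ∀ S : Subgroup X, IsClosed (S : Set X) → 𝒢 S

/-- `K`-stable: `X × K` belongs to `𝒢` for each `X` in `𝒢`. -/
def IsStable (𝒢 : ∀ (X : Type u) [Group X] [TopologicalSpace X], Prop)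
    (K : Type u) [Group K] [TopologicalSpace K] : Prop :=
  ∀ (X : Type u) [Group X] [TopologicalSpace X], 𝒢 X → 𝒢 (X × K)

/-- `𝒢`-regular: there is a regular continuous bijective homomorphism onto a member of `𝒢`. -/
def IsClassRegular (𝒢 : ∀ (X : Type u) [Group X] [TopologicalSpace X], Prop)
    (H : Type u) [Group H] [TopologicalSpace H] : Prop :=
  ∃ (K : Type u) (_ : Group K) (_ : TopologicalSpace K) (h : H →* K),
    𝒢 K ∧ Continuous h ∧ Function.Bijective h ∧ IsRegularMap h

end Paratop

open Paratop Cardinal Topology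

namespace Paratop

open Topology Pointwise Cardinal Filter

/-! For the reverse implication, intersect translates of `♭`-closed neighborhoods with `H`: they
witness regularity of the bijection from `H` onto its image in `G^♭`, which is a closed subgroup and
so lies in `𝒢`.

For the forward implication, let `h : H → K` be regular with `K ∈ 𝒢`, and refine the topology of the
group `K × T`. With invariant bases `V` of `K` and `W` of `T`, a basic neighborhood of the unit
consists of the `(x, t)` with `t ∈ W n` and `x ∈ h(F) * V (k + n)` whenever `t ∈ W k`. Over `t = 1`
every `k` is allowed, so `x` lies in the closure of `h(F)`; for `F` the preimage of a closed set
this returns `F`, and the unit slice is a copy of `H` (`isEmbedding_sliceHom`). Over `t ≠ 1` only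
finitely many `k` matter, so each neighborhood contains an ordinary box
(`exists_box_subset_twistedNhd`). Boxes yield saturation and show that the reflexion is `K × T^♭`
(`reflexionTopology_twisted`), which is in `𝒢` by stability. The Sorgenfrey property bounds the
depth of the factors by the depth of a product. This gives continuity of multiplication
(`mul_mem_twistedNhd`) and `♭`-regularity (`closure_twistedNhd_subset`). -/

/-! ### Bases of invariant neighborhoods of the unit -/

/-- A decreasing neighborhood base at the unit, consisting of sets that are invariant under
conjugation and such that the square of each set lies in its predecessor. -/
structure IsInvariantBase {G : Type*} [Group G] [TopologicalSpace G] (V : ℕ → Set G) : Prop where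
  mem : ∀ n, V n ∈ 𝓝 (1 : G)
  anti : Antitone V
  basis : ∀ U ∈ 𝓝 (1 : G), ∃ n, V n ⊆ U
  conj : ∀ n g, ∀ v ∈ V n, g * v * g⁻¹ ∈ V n
  mul : ∀ n, ∀ x ∈ V (n + 1), ∀ y ∈ V (n + 1), x * y ∈ V n

/-- A countably generated filter has a decreasing base whose members have a property `Q` and
whose successive members are related by `R`, if small members with these properties exist. -/
theorem exists_seq_of_isCountablyGenerated {X : Type*} (l : Filter X) [l.IsCountablyGenerated]
    (Q : Set X → Prop) (R : Set X → Set X → Prop)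
    (hR : ∀ W U U', U ⊆ U' → R W U → R W U')
    (hl : ∀ U ∈ l, ∃ W ∈ l, W ⊆ U ∧ Q W ∧ R W U) (U₀ : Set X) (hU₀ : U₀ ∈ l) :
    ∃ W : ℕ → Set X, (∀ n, W n ∈ l) ∧ Antitone W ∧ (∀ U ∈ l, ∃ n, W n ⊆ U) ∧ W 0 ⊆ U₀ ∧
      (∀ n, Q (W n)) ∧ ∀ n, R (W (n + 1)) (W n) := by
  obtain ⟨B, hB⟩ := l.exists_antitone_basis
  choose f hfl hfs hfQ hfR using hl
  -- Each step shrinks inside `W ∩ B (n + 1)` to obtain a base; `R` then holds relative to this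
  -- intersection, and `hR` enlarges it to `W`.
  let S : ℕ → {U // U ∈ l} := fun n => Nat.rec
    ⟨f (U₀ ∩ B 0) (inter_mem hU₀ (hB.mem 0)), hfl _ _⟩
    (fun n W => ⟨f (W.1 ∩ B (n + 1)) (inter_mem W.2 (hB.mem (n + 1))), hfl _ _⟩) n
  have hsub : ∀ n, (S (n + 1)).1 ⊆ (S n).1 ∩ B (n + 1) := fun n => hfs _ _
  have hSB : ∀ n, (S n).1 ⊆ B n := by
    intro n
    cases n with
    | zero => exact (hfs _ _).trans Set.inter_subset_right
    | succ n => exact (hsub n).trans Set.inter_subset_right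
  refine ⟨fun n => (S n).1, fun n => (S n).2,
    antitone_nat_of_succ_le fun n => (hsub n).trans Set.inter_subset_left, fun U hU => ?_,
    (hfs _ _).trans Set.inter_subset_left, fun n => ?_,
    fun n => hR _ _ _ Set.inter_subset_left (hfR ((S n).1 ∩ B (n + 1)) _)⟩
  · obtain ⟨n, -, hn⟩ := hB.1.mem_iff.1 hU
    exact ⟨n, (hSB n).trans hn⟩
  · cases n with
    | zero => exact hfQ _ _
    | succ n => exact hfQ _ _

theorem IsSIN.exists_invariant {G : Type*} [Group G] [TopologicalSpace G] (hG : IsSIN G)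
    {U : Set G} (hU : U ∈ 𝓝 (1 : G)) :
    ∃ W ∈ 𝓝 (1 : G), W ⊆ U ∧ ∀ g, ∀ w ∈ W, g * w * g⁻¹ ∈ W := by
  obtain ⟨W, hW, -, hWU⟩ := hG U hU
  -- The union of all conjugates of `W` is invariant and still lies in `U`.
  refine ⟨{x | ∃ g, ∃ w ∈ W, x = g * w * g⁻¹},
    mem_of_superset hW fun w hw => ⟨1, w, hw, by simp⟩, ?_, ?_⟩
  · rintro _ ⟨g, w, hw, rfl⟩
    exact hWU g w hw
  · rintro a _ ⟨g, w, hw, rfl⟩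
    exact ⟨a * g, w, hw, by group⟩

theorem exists_nhds_one_mul_subset {G : Type*} [Group G] [TopologicalSpace G] [ContinuousMul G]
    {U : Set G} (hU : U ∈ 𝓝 (1 : G)) :
    ∃ W ∈ 𝓝 (1 : G), ∀ x ∈ W, ∀ y ∈ W, x * y ∈ U := by
  obtain ⟨W, hWo, hW1, hW⟩ := exists_open_nhds_one_mul_subset hU
  exact ⟨W, hWo.mem_nhds hW1, fun x hx y hy => hW (Set.mul_mem_mul hx hy)⟩

theorem IsSIN.exists_isInvariantBase {G : Type*} [Group G] [TopologicalSpace G] [ContinuousMul G]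
    [FirstCountableTopology G] (hG : IsSIN G) : ∃ V : ℕ → Set G, IsInvariantBase V := by
  obtain ⟨V, h1, h2, h3, -, h4, h5⟩ := exists_seq_of_isCountablyGenerated (𝓝 (1 : G))
    (fun W => ∀ g, ∀ w ∈ W, g * w * g⁻¹ ∈ W) (fun W U => ∀ x ∈ W, ∀ y ∈ W, x * y ∈ U)
    (fun W U U' hU hW x hx y hy => hU (hW x hx y hy)) (fun U hU => by
      obtain ⟨A, hA, hAU⟩ := exists_nhds_one_mul_subset hU
      obtain ⟨W, hW, hWA, hWc⟩ := hG.exists_invariant (inter_mem hU hA)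
      exact ⟨W, hW, fun x hx => (hWA hx).1, hWc,
        fun x hx y hy => hAU x (hWA hx).2 y (hWA hy).2⟩) Set.univ univ_mem
  exact ⟨V, h1, h2, h3, h4, h5⟩

/-- An invariant base witnessing regularity and the Sorgenfrey property. -/
structure IsSorgenfreyBase {G : Type*} [Group G] [TopologicalSpace G] (W : ℕ → Set G) : Prop
    extends IsInvariantBase W where
  closure_subset : ∀ n, closure (W (n + 1)) ⊆ W n
  factor : ∀ n, ∀ x ∈ W 0, ∀ y ∈ W 0, x * y ∈ W (n + 1) → x ∈ W n ∧ y ∈ W n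

theorem IsSIN.exists_isSorgenfreyBase {G : Type*} [Group G] [TopologicalSpace G]
    [ContinuousMul G] [FirstCountableTopology G] [RegularSpace G] (hG : IsSIN G)
    (hs : IsSorgenfrey G) : ∃ W : ℕ → Set G, IsSorgenfreyBase W := by
  obtain ⟨-, -, U₀, hU₀, hf⟩ := hs
  -- Starting the sequence inside `U₀` makes the Sorgenfrey condition available on all of `W 0`.
  obtain ⟨W, h1, h2, h3, h0, h4, h5⟩ := exists_seq_of_isCountablyGenerated (𝓝 (1 : G))
    (fun W => ∀ g, ∀ w ∈ W, g * w * g⁻¹ ∈ W) (fun W U => (∀ x ∈ W, ∀ y ∈ W, x * y ∈ U) ∧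
      closure W ⊆ U ∧ ∀ x ∈ U₀, ∀ y ∈ U₀, x * y ∈ W → x ∈ U ∧ y ∈ U)
    (fun W U U' hU hW => ⟨fun x hx y hy => hU (hW.1 x hx y hy), hW.2.1.trans hU,
      fun x hx y hy hxy => (hW.2.2 x hx y hy hxy).imp (@hU _) (@hU _)⟩) (fun U hU => by
      obtain ⟨A, hA, hAU⟩ := exists_nhds_one_mul_subset hU
      obtain ⟨C, hC, hCc, hCU⟩ := exists_mem_nhds_isClosed_subset hU
      obtain ⟨D, hD, hDU⟩ := hf U hU
      obtain ⟨W, hW, hWA, hWc⟩ := hG.exists_invariant (inter_mem (inter_mem hC hA) hD)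
      exact ⟨W, hW, fun x hx => hCU (hWA hx).1.1, hWc,
        fun x hx y hy => hAU x (hWA hx).1.2 y (hWA hy).1.2,
        (closure_minimal (fun x hx => (hWA hx).1.1) hCc).trans hCU,
        fun x hx y hy hxy => hDU x hx y hy (hWA hxy).2⟩) U₀ hU₀
  exact ⟨W, ⟨⟨h1, h2, h3, h4, fun n => (h5 n).1⟩, fun n => (h5 n).2.1,
    fun n x hx y hy => (h5 n).2.2 x (h0 hx) y (h0 hy)⟩⟩

namespace IsInvariantBase

variable {G : Type*} [Group G] [TopologicalSpace G] {V : ℕ → Set G}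

theorem one_mem (hV : IsInvariantBase V) (n : ℕ) : (1 : G) ∈ V n := mem_of_mem_nhds (hV.mem n)

theorem mul_mem (hV : IsInvariantBase V) {k m n : ℕ} (hm : k + 1 ≤ m) (hn : k + 1 ≤ n) {x y : G}
    (hx : x ∈ V m) (hy : y ∈ V n) : x * y ∈ V k :=
  hV.mul k x (hV.anti hm hx) y (hV.anti hn hy)

theorem conj' (hV : IsInvariantBase V) (n : ℕ) (g : G) {v : G} (hv : v ∈ V n) :
    g⁻¹ * v * g ∈ V n := by
  simpa using hV.conj n g⁻¹ v hv

end IsInvariantBase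

/-! ### The group reflexion -/

instance (G : Type u) [Group G] [TopologicalSpace G] : IsTopologicalGroup (Reflexion G) :=
  (reflexionTopology_isLeast G).1.2

theorem nhds_le_nhds_reflexion {G : Type u} [Group G] [τ : TopologicalSpace G] (a : G) :
    𝓝 a ≤ @nhds G (reflexionTopology G) a :=
  nhds_mono (reflexionTopology_isLeast G).1.1

/-- In a first-countable SIN-group the sets `W n * (W n)⁻¹` are neighborhoods of the unit in the
group reflexion. -/
theorem IsInvariantBase.mul_inv_mem_nhds_reflexion {G : Type u} [Group G]
    [τ : TopologicalSpace G] [ContinuousMul G] {W : ℕ → Set G} (hW : IsInvariantBase W) (n : ℕ) :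
    {x | ∃ u ∈ W n, ∃ v ∈ W n, x = u * v⁻¹} ∈ @nhds G (reflexionTopology G) 1 := by
  let D : ℕ → Set G := fun n => {x | ∃ u ∈ W n, ∃ v ∈ W n, x = u * v⁻¹}
  have hD : Antitone D := by
    rintro m n h _ ⟨u, hu, v, hv, rfl⟩
    exact ⟨u, hW.anti h hu, v, hW.anti h hv, rfl⟩
  -- Invariance makes the sets `D n` a base of a group topology, since `u v⁻¹ a b⁻¹ = (u a) (b (a⁻¹
  -- v a))⁻¹`. That topology is weaker than `τ`, hence weaker than the reflexion.
  let B : GroupFilterBasis G :=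
    { sets := Set.range D
      nonempty := ⟨_, 0, rfl⟩
      inter_sets := by
        rintro _ _ ⟨m, rfl⟩ ⟨n, rfl⟩
        exact ⟨_, ⟨max m n, rfl⟩,
          Set.subset_inter (hD (le_max_left m n)) (hD (le_max_right m n))⟩
      one' := by
        rintro _ ⟨n, rfl⟩
        exact ⟨1, hW.one_mem n, 1, hW.one_mem n, by simp⟩
      mul' := by
        rintro _ ⟨n, rfl⟩
        refine ⟨_, ⟨n + 1, rfl⟩, ?_⟩
        rintro _ ⟨_, ⟨u, hu, v, hv, rfl⟩, _, ⟨a, ha, b, hb, rfl⟩, rfl⟩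
        refine ⟨u * a, hW.mul n _ hu _ ha, b * (a⁻¹ * v * a),
          hW.mul n _ hb _ (hW.conj' _ _ hv), ?_⟩
        simp only
        group
      inv' := by
        rintro _ ⟨n, rfl⟩
        refine ⟨_, ⟨n, rfl⟩, ?_⟩
        rintro _ ⟨u, hu, v, hv, rfl⟩
        exact ⟨v, hv, u, hu, by simp⟩
      conj' := by
        rintro g _ ⟨n, rfl⟩
        refine ⟨_, ⟨n, rfl⟩, ?_⟩
        rintro _ ⟨u, hu, v, hv, rfl⟩
        exact ⟨g * u * g⁻¹, hW.conj n g u hu, g * v * g⁻¹, hW.conj n g v hv, by group⟩ }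
  have hle : τ ≤ B.topology := by
    refine le_of_nhds_le_nhds fun a => ?_
    rw [(B.nhds_hasBasis a).ge_iff]
    rintro _ ⟨n, rfl⟩
    have h1 : Tendsto (fun x => a⁻¹ * x) (𝓝 a) (𝓝 1) := by
      have := (continuous_const_mul (a⁻¹ : G)).tendsto a
      rwa [inv_mul_cancel] at this
    filter_upwards [h1 (hW.mem n)] with x hx
    exact ⟨a⁻¹ * x, ⟨a⁻¹ * x, hx, 1, hW.one_mem n, by simp⟩, by simp⟩
  have := (reflexionTopology_isLeast G).2 ⟨hle, B.isTopologicalGroup⟩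
  exact nhds_mono this (B.mem_nhds_one ⟨n, rfl⟩)

/-! ### Paratopological groups from neighborhoods of the unit -/

/-- Invariance of `F` under conjugation makes its left and right translates agree, so continuity of
multiplication need only be checked at the unit. -/
theorem exists_continuousMul_nhds {G : Type*} [Group G] (F : Filter G) (h1 : pure 1 ≤ F)
    (hm : ∀ s ∈ F, ∃ t ∈ F, ∀ x ∈ t, ∀ y ∈ t, x * y ∈ s)
    (hc : ∀ g : G, Tendsto (fun x => g * x * g⁻¹) F F) :
    ∃ τ : TopologicalSpace G, @ContinuousMul G τ _ ∧ ∀ a, @nhds G τ a = F.map (a * ·) := by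
  let τ := TopologicalSpace.mkOfNhds fun a : G => F.map (a * ·)
  have hτ : ∀ a, @nhds G τ a = F.map (a * ·) := by
    intro a
    refine TopologicalSpace.nhds_mkOfNhds _ a (fun b => ?_) ?_
    · have := map_mono (m := (b * ·)) h1
      rwa [map_pure, mul_one] at this
    · intro b s hs
      obtain ⟨t, ht, hts⟩ := hm _ hs
      change ∀ᶠ x in F, s ∈ F.map (b * x * ·)
      filter_upwards [ht] with x hx
      change ∀ᶠ y in F, b * x * y ∈ s
      filter_upwards [ht] with y hy
      simpa [mul_assoc] using hts x hx y hy
  have hτ1 : @nhds G τ 1 = F := by simpa using hτ 1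
  refine ⟨τ, ContinuousMul.of_nhds_one ?_ ?_ ?_, hτ⟩
  · rw [hτ1]
    intro s hs
    obtain ⟨t, ht, hts⟩ := hm s hs
    exact mem_map.2 (mem_of_superset (prod_mem_prod ht ht) fun p hp => hts _ hp.1 _ hp.2)
  · intro a
    rw [hτ1, hτ]
  · intro a
    rw [hτ1, hτ]
    refine le_antisymm ?_ ?_
    · have := map_mono (m := (· * a)) (hc a)
      rw [map_map] at this
      convert this using 2
      ext x; simp
    · have := map_mono (m := (a * ·)) (hc a⁻¹)
      rw [map_map] at this
      convert this using 2
      ext x; simp [mul_assoc]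

/-! ### The character -/

theorem character_spec (X : Type u) [TopologicalSpace X] : ℵ₀ ≤ character X ∧
    ∀ x : X, ∃ B : Set (Set X), #B ≤ character X ∧ (𝓝 x).HasBasis (· ∈ B) id := by
  have : character X ∈ {κ : Cardinal.{u} | ℵ₀ ≤ κ ∧
      ∀ x : X, ∃ B : Set (Set X), #B ≤ κ ∧ (𝓝 x).HasBasis (· ∈ B) id} := by
    refine csInf_mem ⟨max ℵ₀ #(Set X), le_max_left _ _, fun x => ⟨{s | s ∈ 𝓝 x}, ?_,
      (𝓝 x).basis_sets⟩⟩
    exact (mk_set_le _).trans (le_max_right _ _)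
  exact this

theorem character_le {X : Type u} [TopologicalSpace X] {κ : Cardinal.{u}} (hκ : ℵ₀ ≤ κ)
    (h : ∀ x : X, ∃ B : Set (Set X), #B ≤ κ ∧ (𝓝 x).HasBasis (· ∈ B) id) : character X ≤ κ :=
  csInf_le' ⟨hκ, h⟩

theorem character_le_of_isInducing {X Y : Type u} [TopologicalSpace X] [TopologicalSpace Y]
    {f : X → Y} (hf : IsInducing f) : character X ≤ character Y := by
  refine character_le (character_spec Y).1 fun x => ?_
  obtain ⟨B, hB, hb⟩ := (character_spec Y).2 (f x)
  refine ⟨(f ⁻¹' ·) '' B, mk_image_le.trans hB, ?_⟩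
  rw [hf.nhds_eq_comap]
  refine ⟨fun s => ?_⟩
  rw [(hb.comap f).mem_iff]
  simp

/-! ### Regular maps onto closed subgroups of the group reflexion -/

/-- The identity homomorphism from a paratopological group to its group reflexion. -/
def toReflexion (G : Type u) [Group G] : G →* Reflexion G := MonoidHom.id G

theorem continuous_toReflexion (G : Type u) [Group G] [TopologicalSpace G] :
    Continuous (toReflexion G) :=
  continuous_id_iff_le.2 (reflexionTopology_isLeast G).1.1

/-- Translations are continuous in the reflexion, so a `♭`-closed neighborhood of the unit can be
moved to any point. -/
theorem IsFlatRegular.exists_isClosed_preimage {G H : Type u} [Group G] [TopologicalSpace G]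
    [ContinuousMul G] (hG : IsFlatRegular G) [Group H] [TopologicalSpace H] (i : H →* G)
    (hi : IsInducing i) (x : H) {U : Set H} (hU : U ∈ 𝓝 x) :
    ∃ F : Set (Reflexion G), IsClosed F ∧ (fun x => toReflexion G (i x)) ⁻¹' F ∈ 𝓝 x ∧
      (fun x => toReflexion G (i x)) ⁻¹' F ⊆ U := by
  rw [hi.nhds_eq_comap] at hU
  obtain ⟨U', hU', hU'U⟩ := hU
  have h1 : Tendsto (fun y => i x * y) (𝓝 1) (𝓝 (i x)) := by
    have := (continuous_const_mul (i x)).tendsto 1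
    rwa [mul_one] at this
  have h2 : Tendsto (fun y => (i x)⁻¹ * y) (𝓝 (i x)) (𝓝 1) := by
    have := (continuous_const_mul (i x)⁻¹).tendsto (i x)
    rwa [inv_mul_cancel] at this
  obtain ⟨F, hF, hFU, hFc⟩ := hG _ (h1 hU')
  have hFc' : IsClosed (X := Reflexion G) F := hFc
  refine ⟨(fun y : Reflexion G => (toReflexion G (i x))⁻¹ * y) ⁻¹' F,
    hFc'.preimage (continuous_const_mul _), hi.continuous.tendsto x (h2 hF), fun y hy => ?_⟩
  have : i x * ((i x)⁻¹ * i y) ∈ U' := hFU hy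
  rw [mul_inv_cancel_left] at this
  exact hU'U this

/-- A `♭`-closed subgroup of a `♭`-regular paratopological group maps by a regular continuous
bijective homomorphism onto a closed subgroup of the group reflexion. -/
theorem isClassRegular_of_isEmbedding
    {𝒢 : ∀ (X : Type u) [Group X] [TopologicalSpace X], Prop} (h𝒢 : IsClosedHereditary 𝒢)
    {G H : Type u} [Group G] [TopologicalSpace G] [ContinuousMul G] (hG : IsFlatRegular G)
    (hG𝒢 : 𝒢 (Reflexion G)) [Group H] [TopologicalSpace H] (i : H →* G) (hi : IsEmbedding i)
    (hic : IsFlatClosed (i.range : Set G)) : IsClassRegular 𝒢 H := by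
  let j : H →* Reflexion G := (toReflexion G).comp i
  have hj : Continuous j.rangeRestrict :=
    ((continuous_toReflexion G).comp hi.continuous).subtype_mk _
  refine ⟨j.range, inferInstance, inferInstance, j.rangeRestrict,
    h𝒢 (Reflexion G) hG𝒢 j.range hic, hj, ⟨?_, j.rangeRestrict_surjective⟩, ?_⟩
  · exact fun x y hxy => hi.injective (congrArg Subtype.val hxy)
  · intro x U hU
    obtain ⟨F, hF, h1, h2⟩ := hG.exists_isClosed_preimage i hi.isInducing x hU
    have hF' : IsClosed ((↑) ⁻¹' F : Set j.range) := hF.preimage continuous_subtype_val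
    exact ⟨_, hF', hF'.preimage hj, h1, h2⟩

/-! ### The twisted product -/

/-- The product group `K × T`, to be endowed with a topology finer than the product topology. -/
def TwistedProduct (K T : Type u) : Type u := K × T

instance (K T : Type u) [Group K] [Group T] : Group (TwistedProduct K T) :=
  inferInstanceAs (Group (K × T))

section TwistedProduct

variable {H K T : Type u} [Group H] [Group K] [Group T]

/-- The basic neighborhoods of the unit in the twisted product. On the slice over `t` the set is
`h(F) * V k` where `k` grows as `t` tends to the unit. -/
def twistedNhd (h : H →* K) (V : ℕ → Set K) (W : ℕ → Set T) (F : Set H) (n : ℕ) :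
    Set (TwistedProduct K T) :=
  {p | p.2 ∈ W n ∧ ∀ k, p.2 ∈ W k → ∃ f ∈ F, ∃ v ∈ V (k + n), p.1 = h f * v}

variable [TopologicalSpace K] [TopologicalSpace T] {h : H →* K} {V : ℕ → Set K} {W : ℕ → Set T}

theorem twistedNhd_mono (hV : IsInvariantBase V) (hW : IsInvariantBase W) {F F' : Set H}
    (hF : F' ⊆ F) {n m : ℕ} (hn : n ≤ m) : twistedNhd h V W F' m ⊆ twistedNhd h V W F n := by
  rintro p ⟨hp, hp'⟩
  refine ⟨hW.anti hn hp, fun k hk => ?_⟩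
  obtain ⟨f, hf, v, hv, e⟩ := hp' k hk
  exact ⟨f, hF hf, v, hV.anti (by lia) hv, e⟩

/-- If a product in `T` has depth `k`, both factors have depth `k - 1` by the Sorgenfrey property.
The shift by 2 pays for this lost level and for one multiplication in `V`. -/
theorem mul_mem_twistedNhd (hV : IsInvariantBase V) (hW : IsSorgenfreyBase W) {F F' : Set H}
    (hF : ∀ x ∈ F', ∀ y ∈ F', x * y ∈ F) (n : ℕ) {p q : TwistedProduct K T}
    (hp : p ∈ twistedNhd h V W F' (n + 2)) (hq : q ∈ twistedNhd h V W F' (n + 2)) :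
    p * q ∈ twistedNhd h V W F n := by
  refine ⟨hW.mul_mem (by lia) (by lia) hp.1 hq.1, fun k hk => ?_⟩
  -- For `k = 0` the truncated `k - 1` is `0`, where membership is automatic.
  have hpq : p.2 ∈ W (k - 1) ∧ q.2 ∈ W (k - 1) := by
    have hp0 := hW.anti (Nat.zero_le _) hp.1
    have hq0 := hW.anti (Nat.zero_le _) hq.1
    cases k with
    | zero => exact ⟨hp0, hq0⟩
    | succ k => exact hW.factor k _ hp0 _ hq0 hk
  obtain ⟨f, hf, v, hv, e⟩ := hp.2 _ hpq.1
  obtain ⟨f', hf', v', hv', e'⟩ := hq.2 _ hpq.2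
  refine ⟨f * f', hF f hf f' hf', ((h f')⁻¹ * v * h f') * v',
    hV.mul_mem (by lia) (by lia) (hV.conj' _ _ hv) hv', ?_⟩
  change p.1 * q.1 = _
  rw [e, e', map_mul]
  group

/-- Conjugation preserves depth in `T` and each `V k`; on `h(F')` it lifts to conjugation by `a` in
`H`. -/
theorem conj_mem_twistedNhd (hV : IsInvariantBase V) (hW : IsInvariantBase W) {F F' : Set H}
    (g : TwistedProduct K T) {a : H} (ha : h a = g.1) (hF : ∀ x ∈ F', a * x * a⁻¹ ∈ F) (n : ℕ)
    {p : TwistedProduct K T} (hp : p ∈ twistedNhd h V W F' n) :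
    g * p * g⁻¹ ∈ twistedNhd h V W F n := by
  refine ⟨hW.conj n g.2 _ hp.1, fun k hk => ?_⟩
  have hk' : p.2 ∈ W k := by
    have := hW.conj' k g.2 hk
    change g.2⁻¹ * (g.2 * p.2 * g.2⁻¹) * g.2 ∈ W k at this
    simpa [mul_assoc] using this
  obtain ⟨f, hf, v, hv, e⟩ := hp.2 _ hk'
  refine ⟨a * f * a⁻¹, hF f hf, g.1 * v * g.1⁻¹, hV.conj _ _ _ hv, ?_⟩
  change g.1 * p.1 * g.1⁻¹ = _
  rw [e, map_mul, map_mul, map_inv, ha]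
  group

variable [TopologicalSpace H]

theorem one_mem_twistedNhd (hV : IsInvariantBase V) (hW : IsInvariantBase W) {F : Set H}
    (hF : F ∈ 𝓝 (1 : H)) (n : ℕ) : (1 : TwistedProduct K T) ∈ twistedNhd h V W F n :=
  ⟨hW.one_mem n, fun k _ => ⟨1, mem_of_mem_nhds hF, 1, hV.one_mem _, by
    rw [map_one, mul_one]; rfl⟩⟩

variable [ContinuousMul T]

/-- Every basic neighborhood contains a box away from the unit slice. -/
theorem exists_box_subset_twistedNhd [T2Space T] (hT : ¬ DiscreteTopology T)
    (hV : IsInvariantBase V) (hW : IsSorgenfreyBase W) {F : Set H} (hF : F ∈ 𝓝 (1 : H)) (n : ℕ) :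
    ∃ (j m : ℕ) (b : T), ∀ x ∈ V j, ∀ w ∈ W m,
      ((x, b * w) : K × T) ∈ (twistedNhd h V W F n : Set (K × T)) := by
  obtain ⟨b, hb, hb1⟩ : ∃ b ∈ W (n + 1), b ≠ 1 := by
    by_contra! hc
    refine hT (discreteTopology_of_isOpen_singleton_one ?_)
    rw [isOpen_singleton_iff_nhds_eq_pure]
    refine le_antisymm ?_ (pure_le_nhds 1)
    rw [le_pure_iff]
    exact mem_of_superset (hW.mem (n + 1)) hc
  -- Since `b` is outside `closure (W (l + 1))`, a small translate `b * W m` misses `W (l + 1)`.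
  -- There only `k ≤ l` occur, so `V (l + n)` meets all the conditions with `f = 1`.
  obtain ⟨l, hl⟩ := hW.basis {b}ᶜ (isOpen_compl_singleton.mem_nhds (Ne.symm hb1))
  have hbl : b ∉ closure (W (l + 1)) := fun hbc => hl (hW.closure_subset l hbc) rfl
  have hnhd : (b * ·) ⁻¹' (closure (W (l + 1)))ᶜ ∈ 𝓝 (1 : T) :=
    (isClosed_closure.isOpen_compl.preimage (continuous_const_mul b)).mem_nhds (by simpa using hbl)
  obtain ⟨m, hm⟩ := hW.basis _ hnhd
  refine ⟨l + n, max m (n + 1), b, fun x hx w hw => ⟨?_, fun k hk => ?_⟩⟩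
  · exact hW.mul_mem le_rfl (le_max_right _ _) hb hw
  · refine ⟨1, mem_of_mem_nhds hF, x, ?_, by rw [map_one, one_mul]⟩
    refine hV.anti ?_ hx
    have hkl : ¬ l + 1 ≤ k := fun hlk =>
      hm (hW.anti (le_max_left _ _) hw) (subset_closure (hW.anti hlk hk))
    lia

end TwistedProduct

theorem twistedNhd_mem_nhds {H K T : Type u} [Group H] [Group K] [Group T] [TopologicalSpace H]
    [TopologicalSpace (TwistedProduct K T)] {h : H →* K} {V : ℕ → Set K} {W : ℕ → Set T} {F : Set H} (hτ : (𝓝 (1 : TwistedProduct K T)).HasBasis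
      (fun i : Set H × ℕ => i.1 ∈ 𝓝 1) fun i => twistedNhd h V W i.1 i.2)
    (hF : F ∈ 𝓝 (1 : H)) (n : ℕ) : twistedNhd h V W F n ∈ 𝓝 (1 : TwistedProduct K T) :=
  hτ.mem_of_mem (i := (F, n)) hF

/-- The embedding of `H` as the slice over the unit. -/
def sliceHom {H K : Type u} [Group H] [Group K] (h : H →* K) (T : Type u) [Group T] : H →* TwistedProduct K T :=
  (MonoidHom.inl K T).comp h

theorem mk_quotient_range_sliceHom {H K T : Type u} [Group H] [Group K]
    [Group T] {h : H →* K} (hs : Function.Surjective h) :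
    #(TwistedProduct K T ⧸ (sliceHom h T).range) = #T := by
  let φ : TwistedProduct K T →* T := MonoidHom.snd K T
  have hφ : φ.ker = (sliceHom h T).range := by
    ext p
    constructor
    · intro hp
      obtain ⟨x, hx⟩ := hs p.1
      exact ⟨x, Prod.ext hx (Eq.symm hp)⟩
    · rintro ⟨x, rfl⟩
      rfl
  rw [← hφ]
  exact Cardinal.mk_congr (QuotientGroup.quotientKerEquivOfSurjective φ
    fun t => ⟨((1, t) : K × T), rfl⟩).toEquiv

/-- The topology of the product of `K` and the group reflexion of `T`. -/
@[reducible] def productReflexionTopology (K T : Type u) [TopologicalSpace K] [Group T]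
    [TopologicalSpace T] : TopologicalSpace (TwistedProduct K T) :=
  (inferInstance : TopologicalSpace (K × Reflexion T))

theorem isTopologicalGroup_productReflexion (K T : Type u) [Group K] [TopologicalSpace K]
    [IsTopologicalGroup K] [Group T] [TopologicalSpace T] :
    @IsTopologicalGroup (TwistedProduct K T) (productReflexionTopology K T) _ :=
  (inferInstance : IsTopologicalGroup (K × Reflexion T))

/-! ### The twisted topology, its group reflexion, and the embedded copy of `H`. -/

section Topology

variable {H K T : Type u} [Group H] [Group K] [Group T]
  [TopologicalSpace K] [TopologicalSpace T] {h : H →* K} {V : ℕ → Set K} {W : ℕ → Set T}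

/-- A point `p` of the closure is approximated by `q` with `q.2 * u = p.2 * w`. If `p.2` has depth
`k`, this product has depth `k - 1` and `q.2` has depth `k - 2`; the third unit of the shift absorbs
a product in `V`. -/
theorem closure_twistedNhd_subset [IsTopologicalGroup K] [ContinuousMul T]
    (hV : IsInvariantBase V) (hW : IsSorgenfreyBase W) (F : Set H)
    (n : ℕ) : closure[productReflexionTopology K T] (twistedNhd h V W F (n + 3)) ⊆
      twistedNhd h V W F n := by
  intro p hp
  let t : Reflexion T := p.2
  have hcalc : ∀ a y w u : T, a⁻¹ * y = w * u⁻¹ → y * u = a * w := by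
    intro a y w u hay
    rw [inv_mul_eq_iff_eq_mul.1 hay]
    group
  have key : ∀ j, ∃ q ∈ twistedNhd h V W F (n + 3), ∃ v ∈ V j, ∃ u ∈ W j, ∃ w ∈ W j,
      p.1 = q.1 * v ∧ q.2 * u = p.2 * w := by
    intro j
    have hA : {x | x⁻¹ * p.1 ∈ V j} ∈ 𝓝 p.1 := by
      have : Continuous fun x : K => x⁻¹ * p.1 := by fun_prop
      exact this.tendsto' _ _ (inv_mul_cancel _) (hV.mem j)
    have hB : (fun y => t⁻¹ * y) ⁻¹' {x : T | ∃ u ∈ W j, ∃ v ∈ W j, x = u * v⁻¹} ∈ 𝓝 t := by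
      have : Continuous fun y => t⁻¹ * y := by fun_prop
      exact this.tendsto' t 1 (inv_mul_cancel _) (hW.1.mul_inv_mem_nhds_reflexion j)
    obtain ⟨q, hq, hqN⟩ := (mem_closure_iff_nhds (X := K × Reflexion T)).1 hp _
      (@prod_mem_nhds K (Reflexion T) _ _ _ _ _ _ hA hB)
    obtain ⟨hq1, w, hw, u, hu, e⟩ := hq
    refine ⟨q, hqN, _, hq1, u, hu, w, hw, by simp, ?_⟩
    exact hcalc _ _ _ _ e
  refine ⟨hW.closure_subset n (mem_closure_iff_nhds.2 fun s hs => ?_), fun k hk => ?_⟩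
  · obtain ⟨m, hm⟩ := hW.basis ((p.2 * ·) ⁻¹' s)
      ((continuous_const_mul (p.2 : T)).tendsto' 1 p.2 (mul_one _) hs)
    obtain ⟨q, hq, v, hv, u, hu, w, hw, e1, e2⟩ := key (max m (n + 2))
    refine ⟨p.2 * w, hm (hW.anti (le_max_left _ _) hw), ?_⟩
    rw [← e2]
    exact hW.mul_mem (by lia) (le_max_right _ _) hq.1 hu
  · obtain ⟨q, hq, v, hv, u, hu, w, hw, e1, e2⟩ := key (k + n + 3)
    have hq2 : q.2 ∈ W (k - 2) := by
      have hq0 := hW.anti (Nat.zero_le _) hq.1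
      obtain hk2 | ⟨i, rfl⟩ : k - 2 = 0 ∨ ∃ i, k = i + 2 := by
        rcases Nat.lt_or_ge k 3 with hk3 | hk3
        · left; lia
        · exact Or.inr ⟨k - 2, by lia⟩
      · rwa [hk2]
      · refine (hW.factor i q.2 hq0 u (hW.anti (Nat.zero_le _) hu) ?_).1
        rw [e2]
        exact hW.mul_mem le_rfl (by lia) hk hw
    obtain ⟨f, hf, v', hv', e⟩ := hq.2 _ hq2
    exact ⟨f, hf, v' * v, hV.mul_mem (by lia) (by lia) hv' hv, by rw [e1, e, mul_assoc]⟩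

variable [TopologicalSpace H]

theorem exists_twisted_topology [ContinuousMul H]
    (hV : IsInvariantBase V) (hW : IsSorgenfreyBase W)
    (hs : Function.Surjective h) :
    ∃ τ : TopologicalSpace (TwistedProduct K T), @ContinuousMul _ τ _ ∧
      ∀ a, (@nhds _ τ a).HasBasis (fun i : Set H × ℕ => i.1 ∈ 𝓝 1)
        fun i => (a * ·) '' twistedNhd h V W i.1 i.2 := by
  let F : Filter (TwistedProduct K T) :=
    { sets := {s | ∃ U ∈ 𝓝 (1 : H), ∃ n, twistedNhd h V W U n ⊆ s}
      univ_sets := ⟨_, univ_mem, 0, Set.subset_univ _⟩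
      sets_of_superset := fun ⟨U, hU, n, hs⟩ hst => ⟨U, hU, n, hs.trans hst⟩
      inter_sets := fun ⟨U, hU, n, hs⟩ ⟨U', hU', n', hs'⟩ => ⟨U ∩ U', inter_mem hU hU', max n n',
        Set.subset_inter
          ((twistedNhd_mono hV hW.1 Set.inter_subset_left (le_max_left _ _)).trans hs)
          ((twistedNhd_mono hV hW.1 Set.inter_subset_right (le_max_right _ _)).trans hs')⟩ }
  have hF : F.HasBasis (fun i : Set H × ℕ => i.1 ∈ 𝓝 1) fun i => twistedNhd h V W i.1 i.2 :=
    ⟨fun s => ⟨fun ⟨U, hU, n, hs⟩ => ⟨(U, n), hU, hs⟩, fun ⟨i, hi, hs⟩ => ⟨i.1, hi, i.2, hs⟩⟩⟩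
  suffices hτ : ∃ τ : TopologicalSpace (TwistedProduct K T), @ContinuousMul _ τ _ ∧
      ∀ a, @nhds _ τ a = F.map (a * ·) by
    obtain ⟨τ, hτ, hn⟩ := hτ
    exact ⟨τ, hτ, fun a => by rw [hn a]; exact hF.map _⟩
  refine exists_continuousMul_nhds F ?_ ?_ ?_
  · rintro s ⟨U, hU, n, hs⟩
    exact hs (one_mem_twistedNhd hV hW.1 hU n)
  · rintro s ⟨U, hU, n, hs⟩
    obtain ⟨A, hA, hAU⟩ := exists_nhds_one_mul_subset hU
    exact ⟨_, ⟨A, hA, n + 2, subset_rfl⟩, fun x hx y hy =>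
      hs (mul_mem_twistedNhd hV hW hAU n hx hy)⟩
  · rintro g s ⟨U, hU, n, hs'⟩
    obtain ⟨a, ha⟩ := hs g.1
    have hc : Tendsto (fun x => a * x * a⁻¹) (𝓝 1) (𝓝 1) := by
      have : Continuous fun x => a * x * a⁻¹ := by fun_prop
      simpa using this.tendsto 1
    exact ⟨_, hc hU, n, fun p hp => hs' (conj_mem_twistedNhd hV hW.1 g ha (fun _ hx => hx) n hp)⟩

variable [τ : TopologicalSpace (TwistedProduct K T)]

theorem twisted_topology_le [IsTopologicalGroup K] [ContinuousMul T]
    (hV : IsInvariantBase V) (hW : IsSorgenfreyBase W)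
    (hc : Continuous h) (hτ : ∀ a, (@nhds _ τ a).HasBasis (fun i : Set H × ℕ => i.1 ∈ 𝓝 1)
        fun i => (a * ·) '' twistedNhd h V W i.1 i.2) :
    τ ≤ productReflexionTopology K T := by
  refine le_of_nhds_le_nhds fun a s hs => ?_
  obtain ⟨A, hA, B, hB, hAB⟩ := (mem_nhds_prod_iff (X := K) (Y := Reflexion T)).1 hs
  have hB' : B ∈ @nhds T _ a.2 := @nhds_le_nhds_reflexion T _ _ a.2 B hB
  obtain ⟨j, hj⟩ := hV.basis ((a.1 * ·) ⁻¹' A)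
    ((continuous_const_mul a.1).tendsto' 1 a.1 (mul_one _) hA)
  obtain ⟨m, hm⟩ := hW.basis ((a.2 * ·) ⁻¹' B)
    ((continuous_const_mul a.2).tendsto' 1 a.2 (mul_one _) hB')
  have hF : h ⁻¹' V (j + 1) ∈ 𝓝 (1 : H) :=
    hc.tendsto' 1 1 (map_one h) (hV.mem (j + 1))
  refine mem_of_superset ((hτ a).mem_of_mem (i := (_, max m (j + 1))) hF) ?_
  rintro _ ⟨p, hp, rfl⟩
  refine hAB ⟨hj ?_, hm (hW.anti (le_max_left _ _) hp.1)⟩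
  obtain ⟨f, hf, v, hv, e⟩ := hp.2 _ hp.1
  rw [e]
  exact hV.mul_mem le_rfl (by lia) hf hv

/-- A neighborhood of the unit in the reflexion contains some `A * A⁻¹`, and `A` contains a box.
Dividing the box by itself cancels `b` and leaves a neighborhood of the unit in `K × T^♭`. -/
theorem reflexionTopology_twisted [IsTopologicalGroup K] [ContinuousMul T]
    [T2Space T] (hT : ¬ DiscreteTopology T)
    (hV : IsInvariantBase V) (hW : IsSorgenfreyBase W)
    (hle : τ ≤ productReflexionTopology K T)
    (hτ : (𝓝 (1 : TwistedProduct K T)).HasBasis (fun i : Set H × ℕ => i.1 ∈ 𝓝 1)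
      fun i => twistedNhd h V W i.1 i.2) :
    reflexionTopology (TwistedProduct K T) = productReflexionTopology K T := by
  obtain ⟨⟨h1, h2⟩, h3⟩ := reflexionTopology_isLeast (TwistedProduct K T)
  have hP := isTopologicalGroup_productReflexion K T
  refine le_antisymm (h3 ⟨hle, hP⟩) (le_of_nhds_le_nhds fun a => ?_)
  suffices hs : @nhds _ (productReflexionTopology K T) 1 ≤ @nhds _ (reflexionTopology _) 1 by
    rw [← @map_mul_left_nhds_one _ (_) _ hP a, ← @map_mul_left_nhds_one _ (_) _ h2 a]
    exact map_mono hs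
  intro s hs
  obtain ⟨A, hA, hAs⟩ := (@exists_nhds_split_inv _ (_) _ h2 s hs)
  obtain ⟨⟨F, n⟩, hF, hFA⟩ := hτ.mem_iff.1 (nhds_mono h1 hA)
  obtain ⟨j, m, b, hb⟩ := exists_box_subset_twistedNhd (h := h) hT hV hW hF n
  have hbox := @prod_mem_nhds K T _ (reflexionTopology T) _ _ _ _ (hV.mem j)
    (hW.1.mul_inv_mem_nhds_reflexion m)
  refine mem_of_superset hbox ?_
  rintro ⟨x, _⟩ ⟨hx, u, hu, v, hv, rfl⟩
  -- The second coordinates are `u * b` and `v * b`, written in the form `b * w` of the box.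
  have e1 := hFA (hb x hx _ (hW.conj' m b hu))
  have e2 := hFA (hb 1 (hV.one_mem j) _ (hW.conj' m b hv))
  have := hAs _ e1 _ e2
  have e : ((x, u * v⁻¹) : K × T) = (x, b * (b⁻¹ * u * b)) / (1, b * (b⁻¹ * v * b)) := by
    refine Prod.ext (div_one x).symm ?_
    change u * v⁻¹ = b * (b⁻¹ * u * b) / (b * (b⁻¹ * v * b))
    rw [div_eq_mul_inv]
    group
  rw [e]
  exact this

theorem isSaturated_twisted [IsTopologicalGroup K] [ContinuousMul T]
    [ContinuousMul (TwistedProduct K T)]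
    [T2Space T] (hT : ¬ DiscreteTopology T) (hTs : IsSaturated T)
    (hV : IsInvariantBase V) (hW : IsSorgenfreyBase W) (hc : Continuous h)
    (hτ : ∀ a, (@nhds _ τ a).HasBasis (fun i : Set H × ℕ => i.1 ∈ 𝓝 1)
        fun i => (a * ·) '' twistedNhd h V W i.1 i.2) :
    IsSaturated (TwistedProduct K T) := by
  rintro O hO ⟨g, hg⟩
  obtain ⟨⟨F, n⟩, hF, hFO⟩ := (hτ g).mem_iff.1 (hO.mem_nhds hg)
  obtain ⟨j, m, b, hb⟩ := exists_box_subset_twistedNhd (h := h) hT hV hW hF n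
  obtain ⟨D, hDW, hDo, hD1⟩ := mem_nhds_iff.1 (hW.mem m)
  obtain ⟨c, hcD⟩ := hTs D hDo ⟨1, hD1⟩
  obtain ⟨l, hl⟩ := hW.basis ((c * ·) ⁻¹' D⁻¹)
    ((continuous_const_mul c).tendsto' 1 c (mul_one _) (mem_interior_iff_mem_nhds.1 hcD))
  obtain ⟨i, hi⟩ := hV.basis (V j)⁻¹ (inv_mem_nhds_one K (hV.mem j))
  have hF' : h ⁻¹' V (i + 1) ∈ 𝓝 (1 : H) := hc.tendsto' 1 1 (map_one h) (hV.mem (i + 1))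
  -- Chosen so that for `p` near the unit the second coordinate of `(a * p)⁻¹` is `b` times an
  -- inverse of an element near `c`, hence in `b * W m`. Thus `(a * p)⁻¹` lies in the box, and `a *
  -- g⁻¹` is interior to `O⁻¹`.
  let a : TwistedProduct K T := ((1, c * b⁻¹) : K × T)
  refine ⟨a * g⁻¹, mem_interior_iff_mem_nhds.2 ?_⟩
  have hmem : twistedNhd h V W (h ⁻¹' V (i + 1)) (max l (i + 1)) ∈ 𝓝 (1 : TwistedProduct K T) := by
    exact twistedNhd_mem_nhds (by simpa using hτ 1) hF' _
  have ht : Tendsto (fun y => a⁻¹ * y * g) (𝓝 (a * g⁻¹)) (𝓝 1) := by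
    have : Continuous fun y => a⁻¹ * y * g := by fun_prop
    exact this.tendsto' _ _ (by group)
  filter_upwards [ht hmem] with y hy
  obtain ⟨p, hp, rfl⟩ : ∃ p, p ∈ twistedNhd h V W (h ⁻¹' V (i + 1)) (max l (i + 1)) ∧
      y = a * p * g⁻¹ := ⟨_, hy, by group⟩
  obtain ⟨f, hf, v, hv, e⟩ := hp.2 _ hp.1
  have hp1 : p.1⁻¹ ∈ V j := by
    refine hi (?_ : p.1 ∈ V i)
    rw [e]
    exact hV.mul_mem le_rfl (by lia) hf hv
  have hp2 : (c * (b⁻¹ * p.2 * b))⁻¹ ∈ W m :=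
    hDW (hl (hW.conj' l b (hW.anti (le_max_left _ _) hp.1)))
  have hq := hFO ⟨_, hb _ hp1 _ hp2, rfl⟩
  change (a * p * g⁻¹)⁻¹ ∈ O
  convert hq using 1
  have : (a * p)⁻¹ = (p.1⁻¹, b * (c * (b⁻¹ * p.2 * b))⁻¹) := by
    refine Prod.ext ?_ ?_
    · change (1 * p.1)⁻¹ = p.1⁻¹
      simp
    · change (c * b⁻¹ * p.2)⁻¹ = b * (c * (b⁻¹ * p.2 * b))⁻¹
      group
  rw [mul_inv_rev, inv_inv, this]

theorem isFlatRegular_twisted [IsTopologicalGroup K] [ContinuousMul T]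
    (hV : IsInvariantBase V) (hW : IsSorgenfreyBase W)
    (href : reflexionTopology (TwistedProduct K T) = productReflexionTopology K T)
    (hτ : (𝓝 (1 : TwistedProduct K T)).HasBasis (fun i : Set H × ℕ => i.1 ∈ 𝓝 1)
      fun i => twistedNhd h V W i.1 i.2) :
    IsFlatRegular (TwistedProduct K T) := by
  intro U hU
  obtain ⟨⟨F, n⟩, hF, hFU⟩ := hτ.mem_iff.1 hU
  refine ⟨closure[productReflexionTopology K T] (twistedNhd h V W F (n + 3)),
    mem_of_superset (twistedNhd_mem_nhds hτ hF (n + 3))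
      (@subset_closure _ (productReflexionTopology K T) _),
    (closure_twistedNhd_subset hV hW F n).trans hFU, ?_⟩
  rw [IsFlatClosed, href]
  exact @isClosed_closure _ (productReflexionTopology K T) _

theorem isEmbedding_sliceHom [ContinuousMul H] [IsTopologicalGroup K]
    (hV : IsInvariantBase V) (hW : IsInvariantBase W)
    (hinj : Function.Injective h) (hreg : IsRegularMap h)
    (hτ : ∀ a, (@nhds _ τ a).HasBasis (fun i : Set H × ℕ => i.1 ∈ 𝓝 1)
        fun i => (a * ·) '' twistedNhd h V W i.1 i.2) :
    IsEmbedding (sliceHom h T) := by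
  refine ⟨isInducing_iff_nhds.2 fun x => ?_, fun x y hxy => hinj (congrArg Prod.fst hxy)⟩
  have hslice : ∀ y, sliceHom h T y = (h y, 1) := fun y => rfl
  have hcomap := ((hτ (sliceHom h T x)).comap (sliceHom h T))
  apply le_antisymm
  · rw [hcomap.ge_iff]
    rintro ⟨F, n⟩ hF
    have : (fun y => x⁻¹ * y) ⁻¹' F ∈ 𝓝 x :=
      (continuous_const_mul x⁻¹).tendsto' x 1 (inv_mul_cancel x) hF
    filter_upwards [this] with y hy
    refine ⟨sliceHom h T (x⁻¹ * y), ⟨hW.one_mem n, fun k _ => ⟨_, hy, 1, hV.one_mem _, ?_⟩⟩, ?_⟩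
    · rw [mul_one]; rfl
    · simp only [map_mul, map_inv, mul_inv_cancel_left]
  · intro U hU
    have hU' : (fun y => x * y) ⁻¹' U ∈ 𝓝 (1 : H) :=
      (continuous_const_mul x).tendsto' 1 x (mul_one x) hU
    obtain ⟨F, hF, -, hFn, hFU⟩ := hreg 1 _ hU'
    refine hcomap.mem_iff.2 ⟨(_, 0), hFn, ?_⟩
    rintro y ⟨p, hp, hpy⟩
    have hpy' : p = sliceHom h T (x⁻¹ * y) := by
      rw [map_mul, ← hpy, map_inv, inv_mul_cancel_left]
    subst hpy'
    suffices hm : x⁻¹ * y ∈ h ⁻¹' F by simpa using hFU hm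
    -- The unit of `T` lies in every `W n`, so `h (x⁻¹ * y)` is in `h (h ⁻¹' F) * V n` for all `n`,
    -- hence in the closure of `F`.
    refine hF.closure_subset (mem_closure_iff_nhds.2 fun s hs => ?_)
    have hs' : {v : K | h (x⁻¹ * y) * v⁻¹ ∈ s} ∈ 𝓝 (1 : K) := by
      have : Continuous fun v : K => h (x⁻¹ * y) * v⁻¹ := by fun_prop
      exact this.tendsto' _ _ (by simp) hs
    obtain ⟨n, hn⟩ := hV.basis _ hs'
    obtain ⟨f, hf, v, hv, e⟩ := hp.2 n (hW.one_mem n)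
    have e' : h (x⁻¹ * y) = h f * v := e
    have hv' := hn hv
    rw [Set.mem_ofPred_eq, e', mul_inv_cancel_right] at hv'
    exact ⟨_, hv', hf⟩

theorem character_twisted_le (hV : IsInvariantBase V) (hW : IsInvariantBase W)
    (hτ : ∀ a, (@nhds _ τ a).HasBasis (fun i : Set H × ℕ => i.1 ∈ 𝓝 1)
        fun i => (a * ·) '' twistedNhd h V W i.1 i.2) :
    character (TwistedProduct K T) ≤ character H := by
  refine character_le (character_spec H).1 fun a => ?_
  obtain ⟨B, hB, hb⟩ := (character_spec H).2 1
  let f : B × ULift.{u} ℕ → Set (TwistedProduct K T) := fun i =>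
    (a * ·) '' twistedNhd h V W i.1.1 i.2.down
  refine ⟨Set.range f, ?_, ⟨fun s => ?_⟩⟩
  · calc #(Set.range f) ≤ #(B × ULift.{u} ℕ) := mk_range_le
      _ = #B * ℵ₀ := by simp
      _ ≤ character H * character H := mul_le_mul' hB (character_spec H).1
      _ = character H := mul_eq_self (character_spec H).1
  · rw [(hτ a).mem_iff]
    constructor
    · rintro ⟨⟨F, n⟩, hF, hs⟩
      obtain ⟨F', hF', hFF'⟩ := hb.mem_iff.1 hF
      exact ⟨f (⟨F', hF'⟩, ⟨n⟩), ⟨_, rfl⟩,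
        (Set.image_mono (twistedNhd_mono hV hW hFF' le_rfl)).trans hs⟩
    · rintro ⟨_, ⟨i, rfl⟩, hs⟩
      exact ⟨(i.1.1, i.2.down), hb.mem_of_mem i.1.2, hs⟩

end Topology

end Paratop

/-! ### The characterization of `𝒢`-regularity. -/

open Paratop Cardinal Topology
theorem theorem2
    (T : Type u) [Group T] [TopologicalSpace T] [ContinuousMul T] [T2Space T]
    [FirstCountableTopology T] [RegularSpace T]
    (hTsat : IsSaturated T) (hTsor : IsSorgenfrey T) (hTsin : IsSIN T)
    (𝒢 : ∀ (X : Type u) [Group X] [TopologicalSpace X], Prop)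
    (h𝒢 : IsClassOfFirstCountableSINGroups 𝒢)
    (h𝒢closed : IsClosedHereditary 𝒢)
    (h𝒢stable : IsStable 𝒢 (Reflexion T))
    (H : Type u) [Group H] [TopologicalSpace H] [ContinuousMul H] [T2Space H] :
    IsClassRegular 𝒢 H ↔
      ∃ (G : Type u) (_ : Group G) (_ : TopologicalSpace G) (_ : ContinuousMul G)
        (_ : T2Space G) (i : H →* G),
        IsEmbedding i ∧ IsFlatClosed (i.range : Set G) ∧
        IsSaturated G ∧ IsFlatRegular G ∧ 𝒢 (Reflexion G) ∧
        character G = character H ∧ #(G ⧸ i.range) = #T := by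
  constructor
  · rintro ⟨K, _, _, h, hK, hc, hbij, hreg⟩
    obtain ⟨_, _, _, hKsin⟩ := h𝒢 K hK
    have hprod : 𝒢 (K × Reflexion T) := h𝒢stable K hK
    -- Membership in `𝒢` makes `K × T^♭` Hausdorff; this makes the finer twisted topology Hausdorff
    -- and the unit slice `♭`-closed.
    obtain ⟨-, hP2, -, -⟩ := h𝒢 _ hprod
    obtain ⟨V, hV⟩ := hKsin.exists_isInvariantBase
    obtain ⟨W, hW⟩ := hTsin.exists_isSorgenfreyBase hTsor
    obtain ⟨τ, hmul, hτ⟩ := exists_twisted_topology (T := T) hV hW hbij.2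
    have hτ1 : (𝓝 (1 : TwistedProduct K T)).HasBasis (fun i : Set H × ℕ => i.1 ∈ 𝓝 1)
        fun i => twistedNhd h V W i.1 i.2 := by simpa using hτ 1
    have hle := twisted_topology_le hV hW hc hτ
    have href := reflexionTopology_twisted hTsor.1 hV hW hle hτ1
    have hemb := isEmbedding_sliceHom hV hW.1 hbij.1 hreg hτ
    refine ⟨TwistedProduct K T, inferInstance, τ, hmul, @t2Space_antitone _ _ _ hle hP2, sliceHom h T,
      hemb, ?_, isSaturated_twisted hTsor.1 hTsat hV hW hc hτ,
      isFlatRegular_twisted hV hW href hτ1, ?_,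
      le_antisymm (character_twisted_le hV hW.1 hτ) (character_le_of_isInducing hemb.isInducing),
      mk_quotient_range_sliceHom hbij.2⟩
    · rw [IsFlatClosed, href]
      have hrange : ((sliceHom h T).range : Set (TwistedProduct K T)) =
          {p : K × Reflexion T | p = (p.1, 1)} := by
        ext p
        constructor
        · rintro ⟨x, rfl⟩
          rfl
        · intro hp
          obtain ⟨x, hx⟩ := hbij.2 p.1
          exact ⟨x, Prod.ext hx (congrArg Prod.snd hp).symm⟩
      rw [hrange]
      have hclosed : IsClosed {p : K × Reflexion T | p = (p.1, 1)} :=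
        isClosed_eq continuous_id (by fun_prop)
      exact hclosed
    · have key : ∀ σ : TopologicalSpace (TwistedProduct K T), σ = productReflexionTopology K T →
          @𝒢 (TwistedProduct K T) _ σ := by
        rintro _ rfl
        exact hprod
      exact key _ href
  · rintro ⟨G, _, _, _, _, i, hi, hic, -, hG, hG𝒢, -, -⟩
    exact isClassRegular_of_isEmbedding h𝒢closed hG hG𝒢 i hi hic
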